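/- For a finite group $G$ and an element $\sum_{g\in G} a_g g$ of the integral group ring $\mathbb Z[G]$, let $$\mathcal D_G\Big(\sum_{g\in G} a_g g\Big)=\det\big(a_{gh^{-1}}\big)_{g,h\in G}$$ be its group determinant; the values of $\mathcal D_G$ on $\mathbb Z[G]$ are called the integer group determinants of $G$. Let $$G_{13}=\langle X,Y,Z \mid Z^4=Y^4=X^2=1,\ XZ=Z^{-1}X,\ Z^2=Y^2,\ XY=YX,\ ZY=YZ\rangle$$ be SmallGroup(16,13) of the GAP library (the central product of the dihedral group $\langle X,Z\rangle$ of order eight and the cyclic group $\langle Y\rangle$ of order four), and let $D_8$ be the dihedral group of order eight. Then: 1. $G_{13}$ and $\mathbb Z_2\times D_8$ have the same set of integer group determinants. 2. $G_{13}$ and $\mathbb Z_2\times D_8$ are not isomorphic. In particular, the integer group determinants do not determine the group: it is not true that any two finite groups with the same set of integer group determinants are isomorphic. -/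

import Mathlib

/-- The group determinant `det (a_{g h⁻¹})_{g, h ∈ G}` of the element `∑ a_g g` of the integral
group ring `ℤ[G]` of a finite group `G`. -/
def groupDeterminant (G : Type*) [Group G] [Fintype G] [DecidableEq G]
    (a : MonoidAlgebra ℤ G) : ℤ :=
  (Matrix.of fun g h : G => a.coeff (g * h⁻¹)).det

open Classical in
/-- The set of integer group determinants of the finite group `G`: all values taken by the group
determinant on the integral group ring `ℤ[G]`. -/
def integerGroupDeterminants (G : Type*) [Group G] [Fintype G] : Set ℤ :=
  Set.range (groupDeterminant G)

namespace SmallGroup_16_13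

/-- The names of the three generators. -/
inductive Gen : Type
  | X | Y | Z

open FreeGroup in
/-- The relators of the presentation
`⟨X, Y, Z | Z⁴ = Y⁴ = X² = 1, X Z = Z⁻¹ X, Z² = Y², X Y = Y X, Z Y = Y Z⟩`,
each relation `u = v` being written as the relator `u * v⁻¹`. -/
def relators : Set (FreeGroup Gen) :=
  {of .Z ^ 4, of .Y ^ 4, of .X ^ 2,
    (of .X * of .Z) * ((of .Z)⁻¹ * of .X)⁻¹,
    of .Z ^ 2 * (of .Y ^ 2)⁻¹,
    (of .X * of .Y) * (of .Y * of .X)⁻¹,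
    (of .Z * of .Y) * (of .Y * of .Z)⁻¹}

end SmallGroup_16_13

/-- The group `SmallGroup(16,13)` of the GAP library: the central product of the dihedral group
`⟨X, Z⟩` of order eight and the cyclic group `⟨Y⟩` of order four, given by its presentation. -/
abbrev SmallGroup_16_13 : Type := PresentedGroup SmallGroup_16_13.relators

namespace SmallGroup_16_13

/-- Every element of the group is of the form `Z ^ i * Y ^ j * X ^ k`. -/
theorem exists_normal_form (g : SmallGroup_16_13) :
    ∃ (i j : Fin 4) (k : Fin 2),
      g = (PresentedGroup.of .Z) ^ (i : ℕ) * (PresentedGroup.of .Y) ^ (j : ℕ) *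
        (PresentedGroup.of .X) ^ (k : ℕ) := by
  set X : SmallGroup_16_13 := PresentedGroup.of .X with hX
  set Y : SmallGroup_16_13 := PresentedGroup.of .Y with hY
  set Z : SmallGroup_16_13 := PresentedGroup.of .Z with hZ
  have rel : ∀ r ∈ relators, PresentedGroup.mk relators r = 1 :=
    fun r hr => PresentedGroup.one_of_mem hr
  have hZ4 : Z ^ 4 = 1 := rel (FreeGroup.of .Z ^ 4) (by simp [relators])
  have hY4 : Y ^ 4 = 1 := rel (FreeGroup.of .Y ^ 4) (by simp [relators])
  have hX2 : X ^ 2 = 1 := rel (FreeGroup.of .X ^ 2) (by simp [relators])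
  have hXZ : X * Z = Z⁻¹ * X := mul_inv_eq_one.1 <|
    rel ((FreeGroup.of .X * FreeGroup.of .Z) * ((FreeGroup.of .Z)⁻¹ * FreeGroup.of .X)⁻¹)
      (by simp [relators])
  have hXY : X * Y = Y * X := mul_inv_eq_one.1 <|
    rel ((FreeGroup.of .X * FreeGroup.of .Y) * (FreeGroup.of .Y * FreeGroup.of .X)⁻¹)
      (by simp [relators])
  have hZY : Z * Y = Y * Z := mul_inv_eq_one.1 <|
    rel ((FreeGroup.of .Z * FreeGroup.of .Y) * (FreeGroup.of .Y * FreeGroup.of .Z)⁻¹)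
      (by simp [relators])
  have hXi : X⁻¹ = X := by rw [inv_eq_iff_mul_eq_one, ← sq, hX2]
  have hYi : Y⁻¹ = Y ^ 3 := by rw [inv_eq_iff_mul_eq_one, ← pow_succ', hY4]
  have hZi : Z⁻¹ = Z ^ 3 := by rw [inv_eq_iff_mul_eq_one, ← pow_succ', hZ4]
  have hXZn : ∀ n : ℕ, X * Z ^ n = Z ^ (3 * n) * X := by
    intro n
    have h : SemiconjBy X Z (Z ^ 3) := by rw [← hZi]; exact hXZ
    rw [pow_mul]
    exact h.pow_right n
  have cXY : Commute X Y := hXY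
  have cZY : Commute Z Y := hZY
  -- the elements of the required form, with arbitrary natural exponents
  let P : SmallGroup_16_13 → Prop := fun g => ∃ i j k : ℕ, g = Z ^ i * Y ^ j * X ^ k
  have PX : ∀ g, P g → P (X * g) := by
    rintro g ⟨i, j, k, rfl⟩
    refine ⟨3 * i, j, k + 1, ?_⟩
    calc X * (Z ^ i * Y ^ j * X ^ k) = (X * Z ^ i) * Y ^ j * X ^ k := by simp only [mul_assoc]
      _ = Z ^ (3 * i) * (X * Y ^ j) * X ^ k := by rw [hXZn]; simp only [mul_assoc]
      _ = Z ^ (3 * i) * Y ^ j * X ^ (k + 1) := by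
        rw [(cXY.pow_right j).eq, pow_succ']; simp only [mul_assoc]
  have PY : ∀ g, P g → P (Y * g) := by
    rintro g ⟨i, j, k, rfl⟩
    refine ⟨i, j + 1, k, ?_⟩
    rw [← mul_assoc, ← mul_assoc, ← (cZY.pow_left i).eq, pow_succ']
    simp only [mul_assoc]
  have PZ : ∀ g, P g → P (Z * g) := by
    rintro g ⟨i, j, k, rfl⟩
    refine ⟨i + 1, j, k, ?_⟩
    rw [pow_succ']
    simp only [mul_assoc]
  have Pgen : ∀ s : Gen, ∀ g, P g → P (PresentedGroup.of s * g) := by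
    rintro (_ | _ | _)
    exacts [PX, PY, PZ]
  have Pinv : ∀ s : Gen, ∀ g, P g → P ((PresentedGroup.of s)⁻¹ * g) := by
    rintro (_ | _ | _) g hg
    · change P (X⁻¹ * g)
      rw [hXi]; exact PX g hg
    · change P (Y⁻¹ * g)
      rw [hYi, pow_succ, pow_two, mul_assoc, mul_assoc]; exact PY _ (PY _ (PY _ hg))
    · change P (Z⁻¹ * g)
      rw [hZi, pow_succ, pow_two, mul_assoc, mul_assoc]; exact PZ _ (PZ _ (PZ _ hg))
  have hP : P g := by
    have hg : g ∈ Subgroup.closure (Set.range (PresentedGroup.of (rels := relators))) := by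
      rw [PresentedGroup.closure_range_of]; trivial
    induction hg using Subgroup.closure_induction_left with
    | one => exact ⟨0, 0, 0, by simp⟩
    | mul_left x hx y _ ih => obtain ⟨s, rfl⟩ := hx; exact Pgen s y ih
    | inv_mul_cancel x hx y _ ih => obtain ⟨s, rfl⟩ := hx; exact Pinv s y ih
  obtain ⟨i, j, k, rfl⟩ := hP
  refine ⟨⟨i % 4, Nat.mod_lt _ (by norm_num)⟩, ⟨j % 4, Nat.mod_lt _ (by norm_num)⟩,
    ⟨k % 2, Nat.mod_lt _ (by norm_num)⟩, ?_⟩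
  rw [pow_eq_pow_mod i hZ4, pow_eq_pow_mod j hY4, pow_eq_pow_mod k hX2]

instance : Finite SmallGroup_16_13 :=
  Finite.of_surjective
    (fun p : Fin 4 × Fin 4 × Fin 2 =>
      ((PresentedGroup.of .Z) ^ (p.1 : ℕ) * (PresentedGroup.of .Y) ^ (p.2.1 : ℕ) *
        (PresentedGroup.of .X) ^ (p.2.2 : ℕ) : SmallGroup_16_13))
    fun g => by
      obtain ⟨i, j, k, h⟩ := exists_normal_form g
      exact ⟨(i, j, k), h.symm⟩

noncomputable instance : Fintype SmallGroup_16_13 := Fintype.ofFinite _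

end SmallGroup_16_13

/-! Both groups are generated by the dihedral group `⟨X, Z⟩` and a central `Y`, with `Y ^ 2 = 1` (σ
= 1) or `Y ^ 2 = Z ^ 2` (σ = -1). The regular representation splits according to the sign of the
central involution `Z ^ 2`. Where it acts as 1, both groups act through an elementary abelian group
of order eight, which gives two Klein four-group determinants. Where it acts as -1, `Y` is a square
root of σ, and the determinant is the square of `faithfulDet`. Thus each set of determinants
consists of the values of `extensionDet σ` on integer vectors.

For either sign this set is `commonDeterminants`: the integers 1 mod 16, the integers 9 mod 16 with
a divisor ±3 mod 8, and the multiples of 2 ^ 16. Explicit families attain all of these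
(`commonDeterminants_subset`). Conversely, an even value is divisible by 2 ^ 16, by counting factors
of two (`two_pow_sixteen_dvd_extensionDet`). An odd value is 1 mod 8, and if it is 9 mod 16 then one
of its factors is ±3 mod 8 (`mem_commonDeterminants_of_odd`).

The groups are not isomorphic because only the first has a central element of order four. -/

/-- The product of the four characters of the Klein four-group, i.e. its group determinant. -/
def kleinDet (w : Fin 4 → ℤ) : ℤ :=
  (w 0 + w 1 + w 2 + w 3) * (w 0 + w 1 - w 2 - w 3) *
    ((w 0 - w 1 + w 2 - w 3) * (w 0 - w 1 - w 2 + w 3))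

/-- The polar form of the determinant form of the faithful representation of `D₈`. -/
def dihedralForm {R : Type*} [CommRing R] (v w : Fin 4 → R) : R :=
  v 0 * w 0 + v 1 * w 1 - v 2 * w 2 - v 3 * w 3

/-- The determinant of the four-dimensional faithful part, for the central extension with
`Y ^ 2 = 1` (`σ = 1`) or `Y ^ 2 = Z ^ 2` (`σ = -1`). -/
def faithfulDet (σ : ℤ) (p q : Fin 4 → ℤ) : ℤ :=
  (dihedralForm p p + σ * dihedralForm q q) ^ 2 - 4 * σ * dihedralForm p q ^ 2

/-- The group determinant in terms of the coefficients `a`, `b`, `c`, `d` on the four cosets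
of the set `{1, Z, X, ZX}` by `1`, `Z²`, `Y`, `Z² Y`. -/
def extensionDet (σ : ℤ) (a b c d : Fin 4 → ℤ) : ℤ :=
  kleinDet (a + b + (c + d)) * kleinDet (a + b - (c + d)) * faithfulDet σ (a - b) (c - d) ^ 2

/-! ### Factorization of the two group matrices -/

section Matrices

open Matrix

/-- The block of the group matrix of `D₈` on the transversal `{1, Z, X, ZX}` of its center. -/
def dihedralBlock {α : Type*} (a b : Fin 4 → α) : Matrix (Fin 4) (Fin 4) α :=
  !![a 0, b 1, a 2, a 3; a 1, a 0, a 3, b 2; a 2, a 3, a 0, b 1; a 3, b 2, a 1, a 0]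

theorem map_dihedralBlock {α β : Type*} (f : α → β) (a b : Fin 4 → α) :
    (dihedralBlock a b).map f = dihedralBlock (f ∘ a) (f ∘ b) := by
  ext i j
  fin_cases i <;> fin_cases j <;> rfl

variable {R : Type*} [CommRing R]

/-- Conjugation by a unipotent block matrix separates the eigenvalues ±ω of an operator with square
ω². -/
theorem det_fromBlocks_twisted {n : Type*} [Fintype n] [DecidableEq n] (A B : Matrix n n R)
    (ω : R) :
    (fromBlocks A ((ω ^ 2) • B) B A).det = (A + ω • B).det * (A - ω • B).det := by
  have h : fromBlocks 1 (ω • (1 : Matrix n n R)) 0 1 * fromBlocks A ((ω ^ 2) • B) B A *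
      fromBlocks 1 (-ω • (1 : Matrix n n R)) 0 1 =
        fromBlocks (A + ω • B) 0 B (A - ω • B) := by
    simp only [fromBlocks_multiply, one_mul, mul_one, zero_mul, mul_zero, add_zero, zero_add,
      smul_mul_assoc, mul_smul_comm]
    congr 1
    · module
    · module
  have h' := congrArg Matrix.det h
  rw [det_mul, det_mul, det_fromBlocks_zero₂₁, det_fromBlocks_zero₂₁,
    det_fromBlocks_zero₁₂] at h'
  simpa using h'

theorem fromBlocks_sub {l m n o : Type*} (A A' : Matrix l m R) (B B' : Matrix l n R)
    (C C' : Matrix o m R) (D D' : Matrix o n R) :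
    fromBlocks A B C D - fromBlocks A' B' C' D' =
      fromBlocks (A - A') (B - B') (C - C') (D - D') := by
  simp only [sub_eq_add_neg, fromBlocks_neg, fromBlocks_add]

theorem det_fromBlocks_swap {n : Type*} [Fintype n] [DecidableEq n] (A B : Matrix n n R) :
    (fromBlocks A B B A).det = (A + B).det * (A - B).det := by
  simpa using det_fromBlocks_twisted A B (1 : R)

/-- The matrix of the Klein four-group. -/
def kleinMatrix (w : Fin 4 → R) : Matrix (Fin 4) (Fin 4) R :=
  !![w 0, w 1, w 2, w 3; w 1, w 0, w 3, w 2; w 2, w 3, w 0, w 1; w 3, w 2, w 1, w 0]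

/-- The matrix of the faithful part of `D₈`. -/
def faithfulMatrix (w : Fin 4 → R) : Matrix (Fin 4) (Fin 4) R :=
  !![w 0, -w 1, w 2, w 3; w 1, w 0, w 3, -w 2; w 2, w 3, w 0, -w 1; w 3, -w 2, w 1, w 0]

theorem dihedralBlock_add_swap (a b : Fin 4 → R) :
    dihedralBlock a b + dihedralBlock b a = kleinMatrix (a + b) := by
  ext i j
  fin_cases i <;> fin_cases j <;> simp [dihedralBlock, kleinMatrix, add_comm]

theorem dihedralBlock_sub_swap (a b : Fin 4 → R) :
    dihedralBlock a b - dihedralBlock b a = faithfulMatrix (a - b) := by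
  ext i j
  fin_cases i <;> fin_cases j <;> simp [dihedralBlock, faithfulMatrix]

theorem kleinMatrix_add (v w : Fin 4 → R) :
    kleinMatrix v + kleinMatrix w = kleinMatrix (v + w) := by
  ext i j
  fin_cases i <;> fin_cases j <;> simp [kleinMatrix]

theorem kleinMatrix_sub (v w : Fin 4 → R) :
    kleinMatrix v - kleinMatrix w = kleinMatrix (v - w) := by
  ext i j
  fin_cases i <;> fin_cases j <;> simp [kleinMatrix]

theorem faithfulMatrix_add_smul (v w : Fin 4 → R) (ω : R) :
    faithfulMatrix v + ω • faithfulMatrix w = faithfulMatrix (v + ω • w) := by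
  ext i j
  fin_cases i <;> fin_cases j <;> simp [faithfulMatrix] <;> ring

theorem det_kleinMatrix (w : Fin 4 → ℤ) : (kleinMatrix w).det = kleinDet w := by
  simp [kleinMatrix, kleinDet, det_succ_row_zero, Fin.sum_univ_succ, Fin.succAbove]
  ring

theorem det_faithfulMatrix (w : Fin 4 → R) :
    (faithfulMatrix w).det = dihedralForm w w ^ 2 := by
  simp [faithfulMatrix, dihedralForm, det_succ_row_zero, Fin.sum_univ_succ, Fin.succAbove]
  ring

theorem det_faithful_twisted (p q : Fin 4 → R) (ω : R) :
    (fromBlocks (faithfulMatrix p) ((ω ^ 2) • faithfulMatrix q) (faithfulMatrix q)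
      (faithfulMatrix p)).det =
      ((dihedralForm p p + ω ^ 2 * dihedralForm q q) ^ 2 -
        4 * ω ^ 2 * dihedralForm p q ^ 2) ^ 2 := by
  rw [det_fromBlocks_twisted, sub_eq_add_neg, ← neg_smul, faithfulMatrix_add_smul,
    faithfulMatrix_add_smul, det_faithfulMatrix, det_faithfulMatrix]
  simp only [dihedralForm, Pi.add_apply, Pi.smul_apply, smul_eq_mul]
  ring

/-- The eigenvalues of `Y` are ±i here, so the factorization is done over ℂ and pulled back along
the injection of ℤ. -/
theorem det_faithful_neg_one (p q : Fin 4 → ℤ) :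
    (fromBlocks (faithfulMatrix p) (-faithfulMatrix q) (faithfulMatrix q)
      (faithfulMatrix p)).det = faithfulDet (-1) p q ^ 2 := by
  have h := det_faithful_twisted (fun i => (p i : ℂ)) (fun i => (q i : ℂ)) Complex.I
  have hm : ∀ w : Fin 4 → ℤ, (faithfulMatrix w).map (Int.castRingHom ℂ) =
      faithfulMatrix (fun i => (w i : ℂ)) := by
    intro w
    ext i j
    fin_cases i <;> fin_cases j <;> simp [faithfulMatrix]
  have hneg : (-faithfulMatrix q).map (Int.castRingHom ℂ) =
      (Complex.I ^ 2) • faithfulMatrix (fun i => (q i : ℂ)) := by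
    rw [← hm, Complex.I_sq]
    ext i j
    simp
  apply (Int.castRingHom ℂ).injective_int
  rw [RingHom.map_det, RingHom.mapMatrix_apply, fromBlocks_map, hm, hm, hneg, h, Complex.I_sq]
  simp [faithfulDet, dihedralForm]

theorem det_extension_one (a b c d : Fin 4 → ℤ) :
    (fromBlocks
      (fromBlocks (dihedralBlock a b) (dihedralBlock c d) (dihedralBlock c d) (dihedralBlock a b))
      (fromBlocks (dihedralBlock b a) (dihedralBlock d c) (dihedralBlock d c) (dihedralBlock b a))
      (fromBlocks (dihedralBlock b a) (dihedralBlock d c) (dihedralBlock d c) (dihedralBlock b a))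
      (fromBlocks (dihedralBlock a b) (dihedralBlock c d) (dihedralBlock c d)
        (dihedralBlock a b))).det = extensionDet 1 a b c d := by
  have h := det_faithful_twisted (a - b) (c - d) 1
  rw [one_pow, one_smul] at h
  rw [det_fromBlocks_swap, fromBlocks_add, fromBlocks_sub, dihedralBlock_add_swap,
    dihedralBlock_add_swap, dihedralBlock_sub_swap, dihedralBlock_sub_swap, det_fromBlocks_swap,
    kleinMatrix_add, kleinMatrix_sub, det_kleinMatrix, det_kleinMatrix, h, extensionDet,
    faithfulDet]

/-- The upper blocks swap `c` and `d` because `Y⁻¹ = Z ^ 2 * Y`; on the faithful part the swap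
becomes the sign σ = -1. -/
theorem det_extension_neg_one (a b c d : Fin 4 → ℤ) :
    (fromBlocks
      (fromBlocks (dihedralBlock a b) (dihedralBlock d c) (dihedralBlock c d) (dihedralBlock a b))
      (fromBlocks (dihedralBlock b a) (dihedralBlock c d) (dihedralBlock d c) (dihedralBlock b a))
      (fromBlocks (dihedralBlock b a) (dihedralBlock c d) (dihedralBlock d c) (dihedralBlock b a))
      (fromBlocks (dihedralBlock a b) (dihedralBlock d c) (dihedralBlock c d)
        (dihedralBlock a b))).det = extensionDet (-1) a b c d := by
  rw [det_fromBlocks_swap, fromBlocks_add, fromBlocks_sub, dihedralBlock_add_swap,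
    dihedralBlock_add_swap, dihedralBlock_add_swap, dihedralBlock_sub_swap,
    dihedralBlock_sub_swap, dihedralBlock_sub_swap, ← neg_sub c d, add_comm d c]
  have hneg : faithfulMatrix (-(c - d)) = -faithfulMatrix (c - d) := by
    ext i j
    fin_cases i <;> fin_cases j <;> simp [faithfulMatrix]
  rw [hneg, det_faithful_neg_one, det_fromBlocks_swap, kleinMatrix_add, kleinMatrix_sub,
    det_kleinMatrix, det_kleinMatrix, extensionDet]

end Matrices

/-! ### Attaining the common values -/

/-- The common set of integer group determinants of the two groups. -/
def commonDeterminants : Set ℤ :=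
  {n | (∃ k, n = 16 * k + 1) ∨ (∃ k j, n = (8 * k + 3) * (8 * (k + 2 * j) + 3)) ∨
    ∃ k, n = 2 ^ 16 * k}

/-- The values of `extensionDet σ`. -/
def extensionDeterminants (σ : ℤ) : Set ℤ :=
  {n | ∃ a b c d, extensionDet σ a b c d = n}

theorem mem_extensionDeterminants {σ n : ℤ} (a b c d : Fin 4 → ℤ) (h : extensionDet σ a b c d = n) :
    n ∈ extensionDeterminants σ := ⟨a, b, c, d, h⟩

/-- The witness is the identity plus k times the sum of all group elements, which only the trivial
character sees. -/
theorem sixteen_mul_add_one_mem (σ k : ℤ) : 16 * k + 1 ∈ extensionDeterminants σ := by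
  refine mem_extensionDeterminants ![k + 1, k, k, k] ![k, k, k, k] ![k, k, k, k] ![k, k, k, k] ?_
  simp [extensionDet, kleinDet, faithfulDet, dihedralForm]
  ring

/-- The witness is 1 + Z + X plus (k + j) - jY times the sum over the dihedral subgroup. That sum
affects only the two characters trivial on the subgroup, which take the two displayed values. -/
theorem mul_three_mod_eight_mem (σ k j : ℤ) :
    (8 * k + 3) * (8 * (k + 2 * j) + 3) ∈ extensionDeterminants σ := by
  refine mem_extensionDeterminants ![k + j + 1, k + j + 1, k + j + 1, k + j]
    ![k + j, k + j, k + j, k + j] ![-j, -j, -j, -j] ![-j, -j, -j, -j] ?_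
  simp [extensionDet, kleinDet, faithfulDet, dihedralForm]
  ring

theorem two_pow_sixteen_mul_mem {σ : ℤ} (hσ : σ = 1 ∨ σ = -1) (m : ℤ) :
    2 ^ 16 * m ∈ extensionDeterminants σ := by
  have hm : (∃ k, m = 4 * k) ∨ (∃ k, m = 4 * k + 2) ∨ (∃ k, m = 8 * k + 1) ∨
      (∃ k, m = 8 * k + 5) ∨ (∃ k, m = 8 * k + 3) ∨ ∃ k, m = 8 * k + 7 := by
    have : m = 4 * (m / 4) ∨ m = 4 * (m / 4) + 2 ∨ m = 8 * (m / 8) + 1 ∨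
      m = 8 * (m / 8) + 5 ∨ m = 8 * (m / 8) + 3 ∨ m = 8 * (m / 8) + 7 := by omega
    rcases this with h | h | h | h | h | h
    · exact .inl ⟨_, h⟩
    · exact .inr (.inl ⟨_, h⟩)
    · exact .inr (.inr (.inl ⟨_, h⟩))
    · exact .inr (.inr (.inr (.inl ⟨_, h⟩)))
    · exact .inr (.inr (.inr (.inr (.inl ⟨_, h⟩))))
    · exact .inr (.inr (.inr (.inr (.inr ⟨_, h⟩))))
  -- Adding k to every coefficient changes only the trivial character, by 16k. It equals 4m for even
  -- m and 2m for odd m, and the remaining factors multiply to 2 ^ 14 or 2 ^ 15.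
  rcases hm with ⟨k, rfl⟩ | ⟨k, rfl⟩ | ⟨k, rfl⟩ | ⟨k, rfl⟩ | ⟨k, rfl⟩ | ⟨k, rfl⟩
  · refine mem_extensionDeterminants ![k - 1, k, k, k + 1] ![k - 1, k - 1, k, k] ![k, k + 1, k + 1, k]
      ![k, k, k, k] ?_
    rcases hσ with rfl | rfl <;>
    · simp [extensionDet, kleinDet, faithfulDet, dihedralForm]
      ring
  · refine mem_extensionDeterminants ![k, k, k + 1, k + 1] ![k - 1, k, k, k + 1]
      ![k + 1, k + 1, k + 1, k + 1] ![k, k + 1, k + 1, k] ?_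
    rcases hσ with rfl | rfl <;>
    · simp [extensionDet, kleinDet, faithfulDet, dihedralForm]
      ring
  · refine mem_extensionDeterminants ![k, k, k, k + 1] ![k - 1, k, k, k] ![k + 1, k, k, k]
      ![k, k, k, k + 1] ?_
    rcases hσ with rfl | rfl <;>
    · simp [extensionDet, kleinDet, faithfulDet, dihedralForm]
      ring
  · refine mem_extensionDeterminants ![k, k + 1, k + 1, k + 1] ![k, k, k, k + 1]
      ![k + 1, k + 1, k, k + 1] ![k + 1, k, k + 1, k + 1] ?_
    rcases hσ with rfl | rfl <;>
    · simp [extensionDet, kleinDet, faithfulDet, dihedralForm]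
      ring
  · rcases hσ with rfl | rfl
    · refine mem_extensionDeterminants ![k, k, k, k + 1] ![k - 1, k, k, k + 1]
        ![k + 1, k + 1, k, k + 1] ![k + 1, k, k, k + 1] ?_
      simp [extensionDet, kleinDet, faithfulDet, dihedralForm]
      ring
    · refine mem_extensionDeterminants ![k, k, k, k + 1] ![k - 1, k, k, k + 1]
        ![k, k + 1, k + 1, k + 1] ![k, k + 1, k + 1, k] ?_
      simp [extensionDet, kleinDet, faithfulDet, dihedralForm]
      ring
  · rcases hσ with rfl | rfl
    · refine mem_extensionDeterminants ![k, k + 1, k + 1, k + 2] ![k, k, k, k + 1]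
        ![k + 2, k + 1, k + 1, k + 1] ![k + 1, k + 1, k, k + 2] ?_
      simp [extensionDet, kleinDet, faithfulDet, dihedralForm]
      ring
    · refine mem_extensionDeterminants ![k, k + 1, k + 1, k + 2] ![k, k, k, k + 1]
        ![k + 1, k + 2, k + 2, k + 1] ![k, k + 1, k + 1, k + 1] ?_
      simp [extensionDet, kleinDet, faithfulDet, dihedralForm]
      ring

theorem commonDeterminants_subset {σ : ℤ} (hσ : σ = 1 ∨ σ = -1) :
    commonDeterminants ⊆ extensionDeterminants σ := by
  rintro n (⟨k, rfl⟩ | ⟨k, j, rfl⟩ | ⟨k, rfl⟩)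
  · exact sixteen_mul_add_one_mem σ k
  · exact mul_three_mod_eight_mem σ k j
  · exact two_pow_sixteen_mul_mem hσ k

/-! ### Even values: divisibility by 2 ^ 16 -/

theorem sixty_four_dvd_kleinDet {w : Fin 4 → ℤ} (h : Even (w 0 + w 1 + w 2 + w 3))
    (hw : ¬ (w 0 % 2 = w 1 % 2 ∧ w 0 % 2 = w 2 % 2 ∧ w 0 % 2 = w 3 % 2)) :
    2 ^ 6 ∣ kleinDet w := by
  rw [Int.even_iff] at h
  have hcases : w 0 % 2 = w 1 % 2 ∧ w 2 % 2 = w 3 % 2 ∧ w 2 % 2 = 1 - w 0 % 2 ∨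
      w 0 % 2 = w 2 % 2 ∧ w 1 % 2 = w 3 % 2 ∧ w 1 % 2 = 1 - w 0 % 2 ∨
      w 0 % 2 = w 3 % 2 ∧ w 1 % 2 = w 2 % 2 ∧ w 1 % 2 = 1 - w 0 % 2 := by
    rcases Int.emod_two_eq (w 0) with h0 | h0 <;> rcases Int.emod_two_eq (w 1) with h1 | h1 <;>
      rcases Int.emod_two_eq (w 2) with h2 | h2 <;> rcases Int.emod_two_eq (w 3) with h3 | h3 <;>
      rw [h0, h1, h2, h3] at hw ⊢ <;> omega
  clear hw
  have key : ∀ x y z t : ℤ, 4 ∣ x → 4 ∣ y → 2 ∣ z → 2 ∣ t → 2 ^ 6 ∣ x * y * (z * t) := by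
    rintro _ _ _ _ ⟨x, rfl⟩ ⟨y, rfl⟩ ⟨z, rfl⟩ ⟨t, rfl⟩
    exact ⟨x * y * z * t, by ring⟩
  unfold kleinDet
  generalize hx : w 0 + w 1 + w 2 + w 3 = x
  generalize hy : w 0 + w 1 - w 2 - w 3 = y
  generalize hz : w 0 - w 1 + w 2 - w 3 = z
  generalize ht : w 0 - w 1 - w 2 + w 3 = t
  -- Two coordinates are odd and two even, so the four even characters form two pairs congruent mod
  -- 4, and the pairs differ by 2 mod 4. Exactly one pair is divisible by 4.
  have h2 : 2 ∣ x ∧ 2 ∣ y ∧ 2 ∣ z ∧ 2 ∣ t := by omega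
  obtain ⟨h2x, h2y, h2z, h2t⟩ := h2
  rcases hcases with hc | hc | hc
  · rcases Int.emod_two_eq (x / 2) with hx2 | hx2
    · exact key x y z t (by omega) (by omega) h2z h2t
    · convert key z t x y (by omega) (by omega) h2x h2y using 1; ring
  · rcases Int.emod_two_eq (x / 2) with hx2 | hx2
    · convert key x z y t (by omega) (by omega) h2y h2t using 1; ring
    · convert key y t x z (by omega) (by omega) h2x h2z using 1; ring
  · rcases Int.emod_two_eq (x / 2) with hx2 | hx2
    · convert key x t y z (by omega) (by omega) h2y h2z using 1; ring
    · convert key y z x t (by omega) (by omega) h2x h2t using 1; ring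

theorem sixteen_dvd_kleinDet {w : Fin 4 → ℤ} (h : Even (w 0 + w 1 + w 2 + w 3)) :
    2 ^ 4 ∣ kleinDet w := by
  rw [Int.even_iff] at h
  unfold kleinDet
  obtain ⟨x, hx⟩ : 2 ∣ w 0 + w 1 + w 2 + w 3 := by omega
  obtain ⟨y, hy⟩ : 2 ∣ w 0 + w 1 - w 2 - w 3 := by omega
  obtain ⟨z, hz⟩ : 2 ∣ w 0 - w 1 + w 2 - w 3 := by omega
  obtain ⟨t, ht⟩ : 2 ∣ w 0 - w 1 - w 2 + w 3 := by omega
  rw [hx, hy, hz, ht]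
  exact ⟨x * y * z * t, by ring⟩

theorem two_pow_eight_dvd_kleinDet {w : Fin 4 → ℤ}
    (hw : w 0 % 2 = w 1 % 2 ∧ w 0 % 2 = w 2 % 2 ∧ w 0 % 2 = w 3 % 2)
    (h : 4 ∣ w 0 + w 1 + w 2 + w 3) : 2 ^ 8 ∣ kleinDet w := by
  unfold kleinDet
  obtain ⟨y, hy⟩ : 4 ∣ w 0 + w 1 - w 2 - w 3 := by omega
  obtain ⟨z, hz⟩ : 4 ∣ w 0 - w 1 + w 2 - w 3 := by omega
  obtain ⟨t, ht⟩ : 4 ∣ w 0 - w 1 - w 2 + w 3 := by omega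
  obtain ⟨x, hx⟩ := h
  rw [hx, hy, hz, ht]
  exact ⟨x * y * z * t, by ring⟩

theorem sq_emod_four (x : ℤ) : x * x % 4 = x % 2 := by
  rcases Int.even_or_odd' x with ⟨k, rfl | rfl⟩ <;> ring_nf <;> omega

theorem four_dvd_faithfulDet (σ : ℤ) (hσ : σ = 1 ∨ σ = -1) {p q : Fin 4 → ℤ}
    (h : Even (p 0 + p 1 + p 2 + p 3 + (q 0 + q 1 + q 2 + q 3))) : 4 ∣ faithfulDet σ p q := by
  have hs : 2 ∣ dihedralForm p p + σ * dihedralForm q q := by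
    rw [Int.even_iff] at h
    have hp i := sq_emod_four (p i)
    have hq i := sq_emod_four (q i)
    have := hp 0; have := hp 1; have := hp 2; have := hp 3
    have := hq 0; have := hq 1; have := hq 2; have := hq 3
    unfold dihedralForm
    rcases hσ with rfl | rfl <;> omega
  obtain ⟨t, ht⟩ := hs
  rw [faithfulDet, ht]
  exact ⟨t ^ 2 - σ * dihedralForm p q ^ 2, by ring⟩

theorem mul_emod_two_of_eq {x y : ℤ} (h : y % 2 = x % 2) : x * y % 2 = x % 2 := by
  rw [Int.mul_emod, h]; rcases Int.emod_two_eq x with h | h <;> simp [h]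

theorem mul_emod_two_of_ne {x y : ℤ} (h : y % 2 ≠ x % 2) : x * y % 2 = 0 := by
  rw [Int.mul_emod]
  rcases Int.emod_two_eq x with hx | hx <;> rcases Int.emod_two_eq y with hy | hy <;> simp_all

/-- Squares are 0 or 1 mod 4, so the form at q is plus or minus the form at p mod 4. The latter is
even, hence both combinations vanish mod 4. -/
theorem sixteen_dvd_faithfulDet (σ : ℤ) (hσ : σ = 1 ∨ σ = -1) {p q : Fin 4 → ℤ}
    (hp : Even (p 0 + p 1 + p 2 + p 3))
    (h : (∀ i, q i % 2 = p i % 2) ∨ ∀ i, q i % 2 ≠ p i % 2) : 2 ^ 4 ∣ faithfulDet σ p q := by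
  rw [Int.even_iff] at hp
  have hB : 2 ∣ dihedralForm p q := by
    unfold dihedralForm
    rcases h with h | h
    · have h' i := mul_emod_two_of_eq (h i)
      have := h' 0; have := h' 1; have := h' 2; have := h' 3
      omega
    · have h' i := mul_emod_two_of_ne (h i)
      have := h' 0; have := h' 1; have := h' 2; have := h' 3
      omega
  have hQ : 4 ∣ dihedralForm p p + σ * dihedralForm q q := by
    have hp' i := sq_emod_four (p i)
    have hq' i := sq_emod_four (q i)
    have := hp' 0; have := hp' 1; have := hp' 2; have := hp' 3
    have := hq' 0; have := hq' 1; have := hq' 2; have := hq' 3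
    unfold dihedralForm
    rcases h with h | h
    · have := h 0; have := h 1; have := h 2; have := h 3
      rcases hσ with rfl | rfl <;> omega
    · have h' : ∀ i, q i % 2 = 1 - p i % 2 := fun i => by have := h i; omega
      have := h' 0; have := h' 1; have := h' 2; have := h' 3
      rcases hσ with rfl | rfl <;> omega
  obtain ⟨t, ht⟩ := hQ
  obtain ⟨u, hu⟩ := hB
  rw [faithfulDet, ht, hu]
  exact ⟨t ^ 2 - σ * u ^ 2, by ring⟩

theorem two_pow_sixteen_dvd_extensionDet (σ : ℤ) (hσ : σ = 1 ∨ σ = -1) (a b c d : Fin 4 → ℤ)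
    (h : Even (a 0 + a 1 + a 2 + a 3 + (b 0 + b 1 + b 2 + b 3) + (c 0 + c 1 + c 2 + c 3) +
      (d 0 + d 1 + d 2 + d 3))) :
    2 ^ 16 ∣ extensionDet σ a b c d := by
  rw [Int.even_iff] at h
  rw [extensionDet]
  set v := a + b + (c + d) with hv
  set w := a + b - (c + d) with hw
  have hvi i : v i = a i + b i + (c i + d i) := rfl
  have hwi i : w i = a i + b i - (c i + d i) := rfl
  have hvs : Even (v 0 + v 1 + v 2 + v 3) := by rw [Int.even_iff]; simp only [hvi]; omega
  have hws : Even (w 0 + w 1 + w 2 + w 3) := by rw [Int.even_iff]; simp only [hwi]; omega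
  have hM : 4 ∣ faithfulDet σ (a - b) (c - d) := by
    refine four_dvd_faithfulDet σ hσ ?_
    rw [Int.even_iff]
    simp only [Pi.sub_apply]
    omega
  have twelve : 2 ^ 12 ∣ kleinDet v * kleinDet w →
      2 ^ 16 ∣ kleinDet v * kleinDet w * faithfulDet σ (a - b) (c - d) ^ 2 := fun h => by
    simpa [← pow_add] using mul_dvd_mul h (pow_dvd_pow_of_dvd hM 2)
  by_cases hpar : v 0 % 2 = v 1 % 2 ∧ v 0 % 2 = v 2 % 2 ∧ v 0 % 2 = v 3 % 2
  · have hpar' : w 0 % 2 = w 1 % 2 ∧ w 0 % 2 = w 2 % 2 ∧ w 0 % 2 = w 3 % 2 := by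
      simp only [hvi, hwi] at hpar ⊢; omega
    by_cases hv4 : 4 ∣ v 0 + v 1 + v 2 + v 3
    · exact twelve (by
        simpa [← pow_add] using
          mul_dvd_mul (two_pow_eight_dvd_kleinDet hpar hv4) (sixteen_dvd_kleinDet hws))
    by_cases hw4 : 4 ∣ w 0 + w 1 + w 2 + w 3
    · exact twelve (by
        simpa [← pow_add] using
          mul_dvd_mul (sixteen_dvd_kleinDet hvs) (two_pow_eight_dvd_kleinDet hpar' hw4))
    -- Both coordinate sums are 2 mod 4, so their half-sum, the sum of a + b, is even. Constant
    -- parity of v makes c - d congruent to a - b or to its complement mod 2.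
    have hM' : 2 ^ 4 ∣ faithfulDet σ (a - b) (c - d) := by
      refine sixteen_dvd_faithfulDet σ hσ ?_ ?_
      · rw [Int.even_iff]
        simp only [Pi.sub_apply, hvi, hwi] at *
        omega
      · simp only [hvi] at hpar
        rcases Int.emod_two_eq (a 0 + b 0 + (c 0 + d 0)) with h0 | h0
        · left
          intro i
          fin_cases i <;> simp <;> omega
        · right
          intro i
          fin_cases i <;> simp <;> omega
    simpa [← pow_add] using
      mul_dvd_mul (mul_dvd_mul (sixteen_dvd_kleinDet hvs) (sixteen_dvd_kleinDet hws))
        (pow_dvd_pow_of_dvd hM' 2)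
  · refine twelve ?_
    have hpar' : ¬ (w 0 % 2 = w 1 % 2 ∧ w 0 % 2 = w 2 % 2 ∧ w 0 % 2 = w 3 % 2) := by
      simp only [hvi, hwi] at hpar ⊢; omega
    simpa [← pow_add] using
      mul_dvd_mul (sixty_four_dvd_kleinDet hvs hpar) (sixty_four_dvd_kleinDet hws hpar')

/-! ### Odd values: residues mod 8 and mod 16 -/

-- The residue depends only on parities, so the two Klein factors, whose arguments agree mod 2, are
-- congruent mod 8.
set_option maxHeartbeats 1000000 in
theorem kleinDet_emod_eight {w : Fin 4 → ℤ} (h : Odd (w 0 + w 1 + w 2 + w 3)) :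
    kleinDet w % 8 = 1 + 4 * ((w 0 % 2 + w 1 % 2 + w 2 % 2 + w 3 % 2) / 2) := by
  unfold kleinDet
  rw [Int.odd_iff] at h
  generalize w 0 = x at *
  generalize w 1 = y at *
  generalize w 2 = z at *
  generalize w 3 = t at *
  rcases Int.even_or_odd' x with ⟨x, rfl | rfl⟩ <;> rcases Int.even_or_odd' y with ⟨y, rfl | rfl⟩ <;>
  rcases Int.even_or_odd' z with ⟨z, rfl | rfl⟩ <;> rcases Int.even_or_odd' t with ⟨t, rfl | rfl⟩ <;>
  first
  | omega
  | ring_nf; omega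

theorem kleinDet_emod_sixteen {w : Fin 4 → ℤ} {g : Fin 4} (hg : Odd (w g)) {e : ℤ}
    (he : e = 0 ∨ e = 1) (h : ∀ i ≠ g, w i % 4 = 2 * e) : kleinDet w % 16 = 1 + 8 * e := by
  have key : ∀ j x y z u : ℤ, u = 1 ∨ u = 3 →
      kleinDet ![4 * j + u, 4 * x + 2 * e, 4 * y + 2 * e, 4 * z + 2 * e] % 16 = 1 + 8 * e := by
    intro j x y z u hu
    rcases hu with rfl | rfl <;> rcases he with rfl | rfl <;> simp [kleinDet] <;> ring_nf <;>
      omega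
  have hu : w g % 4 = 1 ∨ w g % 4 = 3 := by rw [Int.odd_iff] at hg; omega
  have hg' : w g = 4 * (w g / 4) + w g % 4 := by omega
  have h' : ∀ i ≠ g, w i = 4 * (w i / 4) + 2 * e := fun i hi => by have := h i hi; omega
  have hcase : g = 0 ∨ g = 1 ∨ g = 2 ∨ g = 3 := by fin_cases g <;> simp
  rcases hcase with rfl | rfl | rfl | rfl
  -- Translations in the Klein four-group preserve `kleinDet` and move the odd coordinate to
  -- position 0.
  · have := key (w 0 / 4) (w 1 / 4) (w 2 / 4) (w 3 / 4) _ hu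
    rw [← h' 1 (by decide), ← h' 2 (by decide), ← h' 3 (by decide), ← hg'] at this
    rw [← this]
    simp [kleinDet]
  · have := key (w 1 / 4) (w 0 / 4) (w 3 / 4) (w 2 / 4) _ hu
    rw [← h' 0 (by decide), ← h' 2 (by decide), ← h' 3 (by decide), ← hg'] at this
    rw [← this]
    simp [kleinDet]
    ring_nf
  · have := key (w 2 / 4) (w 3 / 4) (w 0 / 4) (w 1 / 4) _ hu
    rw [← h' 0 (by decide), ← h' 1 (by decide), ← h' 3 (by decide), ← hg'] at this
    rw [← this]
    simp [kleinDet]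
    ring_nf
  · have := key (w 3 / 4) (w 2 / 4) (w 1 / 4) (w 0 / 4) _ hu
    rw [← h' 0 (by decide), ← h' 1 (by decide), ← h' 2 (by decide), ← hg'] at this
    rw [← this]
    simp [kleinDet]
    ring_nf

/-- Two of these characters sum to 2 mod 4, so they cannot be opposite mod 8 and must agree; their
difference then gives the congruence. -/
theorem emod_four_eq_of_characters {x y z t : ℤ} (hx : x % 2 = 1) (hy : y % 2 = 0)
    (hz : z % 2 = 0) (ht : t % 2 = 0)
    (h₁ : (x + y + z + t) % 8 = 1 ∨ (x + y + z + t) % 8 = 7)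
    (h₂ : (x + y - z - t) % 8 = 1 ∨ (x + y - z - t) % 8 = 7)
    (h₃ : (x - y + z - t) % 8 = 1 ∨ (x - y + z - t) % 8 = 7) : y % 4 = z % 4 ∧ y % 4 = t % 4 := by
  have h₁₂ : z % 4 = t % 4 := by
    clear h₃
    omega
  have h₁₃ : y % 4 = t % 4 := by
    clear h₂ h₁₂
    omega
  omega

/-- The characters would make x + y, x + z and y + z all divisible by 4, although x + y + z is odd.
-/
theorem characters_ne_of_three_odd {x y z t : ℤ} (hx : x % 2 = 1) (hy : y % 2 = 1)
    (hz : z % 2 = 1) (ht : t % 2 = 0)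
    (h₁ : (x + y + z + t) % 8 = 1 ∨ (x + y + z + t) % 8 = 7)
    (h₂ : (x + y - z - t) % 8 = 1 ∨ (x + y - z - t) % 8 = 7)
    (h₃ : (x - y + z - t) % 8 = 1 ∨ (x - y + z - t) % 8 = 7)
    (h₄ : (x - y - z + t) % 8 = 1 ∨ (x - y - z + t) % 8 = 7) : False := by
  rcases h₁ with h₁ | h₁ <;> rcases h₂ with h₂ | h₂ <;> rcases h₃ with h₃ | h₃ <;>
    rcases h₄ with h₄ | h₄ <;> omega

theorem exists_odd_coord_of_characters {w : Fin 4 → ℤ}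
    (h₁ : (w 0 + w 1 + w 2 + w 3) % 8 = 1 ∨ (w 0 + w 1 + w 2 + w 3) % 8 = 7)
    (h₂ : (w 0 + w 1 - w 2 - w 3) % 8 = 1 ∨ (w 0 + w 1 - w 2 - w 3) % 8 = 7)
    (h₃ : (w 0 - w 1 + w 2 - w 3) % 8 = 1 ∨ (w 0 - w 1 + w 2 - w 3) % 8 = 7)
    (h₄ : (w 0 - w 1 - w 2 + w 3) % 8 = 1 ∨ (w 0 - w 1 - w 2 + w 3) % 8 = 7) :
    ∃ g, Odd (w g) ∧ ∃ e, (e = 0 ∨ e = 1) ∧ ∀ i ≠ g, w i % 4 = 2 * e := by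
  have of_pattern : ∀ g : Fin 4, w g % 2 = 1 → ∀ i j k : Fin 4, w i % 2 = 0 →
      w i % 4 = w j % 4 ∧ w i % 4 = w k % 4 → (∀ l ≠ g, l = i ∨ l = j ∨ l = k) →
      ∃ g, Odd (w g) ∧ ∃ e, (e = 0 ∨ e = 1) ∧ ∀ i ≠ g, w i % 4 = 2 * e := by
    intro g hg i j k hi hijk hl
    refine ⟨g, Int.odd_iff.2 hg, w i % 4 / 2, by omega, fun l hlg => ?_⟩
    rcases hl l hlg with rfl | rfl | rfl <;> omega
  rcases Int.emod_two_eq (w 0) with p0 | p0 <;> rcases Int.emod_two_eq (w 1) with p1 | p1 <;>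
    rcases Int.emod_two_eq (w 2) with p2 | p2 <;> rcases Int.emod_two_eq (w 3) with p3 | p3
  · clear h₂ h₃ h₄; omega
  · exact of_pattern 3 p3 2 1 0 p2
      (emod_four_eq_of_characters p3 p2 p1 p0 (by omega) (by omega) (by omega)) (by decide)
  · exact of_pattern 2 p2 3 0 1 p3
      (emod_four_eq_of_characters p2 p3 p0 p1 (by omega) (by omega) (by omega)) (by decide)
  · clear h₂ h₃ h₄; omega
  · exact of_pattern 1 p1 0 3 2 p0
      (emod_four_eq_of_characters p1 p0 p3 p2 (by omega) (by omega) (by omega)) (by decide)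
  · clear h₂ h₃ h₄; omega
  · clear h₂ h₃ h₄; omega
  · exact (characters_ne_of_three_odd p3 p2 p1 p0 (by omega) (by omega) (by omega)
      (by omega)).elim
  · exact of_pattern 0 p0 1 2 3 p1
      (emod_four_eq_of_characters p0 p1 p2 p3 (by omega) (by omega) (by omega)) (by decide)
  · clear h₂ h₃ h₄; omega
  · clear h₂ h₃ h₄; omega
  · exact (characters_ne_of_three_odd p2 p3 p0 p1 (by omega) (by omega) (by omega)
      (by omega)).elim
  · clear h₂ h₃ h₄; omega
  · exact (characters_ne_of_three_odd p1 p0 p3 p2 (by omega) (by omega) (by omega)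
      (by omega)).elim
  · exact (characters_ne_of_three_odd p0 p1 p2 p3 (by omega) (by omega) (by omega)
      (by omega)).elim
  · clear h₂ h₃ h₄; omega

theorem faithfulDet_emod_eight (σ : ℤ) (hσ : σ = 1 ∨ σ = -1) {p q : Fin 4 → ℤ}
    (hs : Odd (p 0 + p 1 + p 2 + p 3 + (q 0 + q 1 + q 2 + q 3)))
    (hB : Odd (p 0 * q 0 + p 1 * q 1 + p 2 * q 2 + p 3 * q 3)) :
    faithfulDet σ p q % 8 = 5 := by
  have hQ : Odd (dihedralForm p p + σ * dihedralForm q q) := by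
    unfold dihedralForm
    rcases hσ with rfl | rfl <;> rw [← Int.not_even_iff_odd] at hs ⊢ <;>
      simp only [Int.even_add, Int.even_sub, Int.even_mul, one_mul, neg_mul, even_neg, or_self]
        at hs ⊢ <;> tauto
  have hB' : Odd (dihedralForm p q) := by
    unfold dihedralForm
    rw [Int.odd_iff] at hB ⊢
    omega
  have h1 := Int.sq_mod_four_eq_one_of_odd hB'
  obtain ⟨t, ht⟩ := hQ
  have h2 : Even (t * (t + 1)) := Int.even_mul_succ_self t
  obtain ⟨s, hs⟩ := h2
  rw [faithfulDet, ht]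
  have h3 : (2 * t + 1) ^ 2 = 8 * s + 1 := by linear_combination 4 * hs
  rw [h3]
  rcases hσ with rfl | rfl <;> omega

/-- The cofactor is also 3 mod 8, after a sign change if m is 5 mod 8. The residue 9 mod 16 then
forces the two quotients by 8 to have equal parity. -/
theorem mem_commonDeterminants_of_dvd {n m : ℤ} (hn : n % 16 = 9) (hm : m ∣ n)
    (h : m % 8 = 3 ∨ m % 8 = 5) : n ∈ commonDeterminants := by
  have key : ∀ x : ℤ, x % 8 = 3 → x ∣ n → n ∈ commonDeterminants := by
    rintro x hx ⟨y, rfl⟩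
    have hy : y % 8 = 3 := by
      have h1 : (x * y) % 8 = 1 := by omega
      rw [Int.mul_emod, hx] at h1
      omega
    have hx' : x = 8 * (x / 8) + 3 := by omega
    have hy' : y = 8 * (y / 8) + 3 := by omega
    generalize x / 8 = k at hx'
    generalize y / 8 = l at hy'
    subst hx' hy'
    have h2 : (l - k) % 2 = 0 := by ring_nf at hn; omega
    refine .inr (.inl ⟨k, (l - k) / 2, ?_⟩)
    congr 1
    omega
  rcases h with h | h
  · exact key m h hm
  · exact key (-m) (by omega) (by simpa using hm)

theorem extensionDet_emod_eight {σ : ℤ} {a b c d : Fin 4 → ℤ} (h : Odd (extensionDet σ a b c d)) :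
    extensionDet σ a b c d % 8 = 1 := by
  rw [extensionDet] at h ⊢
  set v := a + b + (c + d) with hv
  set w := a + b - (c + d) with hw
  have hvw i : w i % 2 = v i % 2 := by
    have hvi : v i = a i + b i + (c i + d i) := rfl
    have hwi : w i = a i + b i - (c i + d i) := rfl
    omega
  obtain ⟨⟨hv1, hw1⟩, hM⟩ := (by simpa [Int.odd_mul, Int.odd_pow] using h :
    (Odd (kleinDet v) ∧ Odd (kleinDet w)) ∧ Odd (faithfulDet σ (a - b) (c - d)))
  have odd_sum : ∀ u : Fin 4 → ℤ, Odd (kleinDet u) → Odd (u 0 + u 1 + u 2 + u 3) := fun u hu =>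
    (Int.odd_mul.1 (Int.odd_mul.1 hu).1).1
  have h1 := kleinDet_emod_eight (odd_sum v hv1)
  have h2 := kleinDet_emod_eight (odd_sum w hw1)
  rw [hvw, hvw, hvw, hvw, ← h1] at h2
  have h3 : ∀ x : ℤ, x % 2 = 1 → x * x % 8 = 1 := fun x hx => by
    have : x % 8 = 1 ∨ x % 8 = 3 ∨ x % 8 = 5 ∨ x % 8 = 7 := by omega
    rw [Int.mul_emod]
    rcases this with h | h | h | h <;> rw [h] <;> norm_num
  rw [Int.odd_iff] at hv1 hM
  rw [Int.mul_emod, Int.mul_emod (kleinDet v), h2, ← Int.mul_emod (kleinDet v), h3 _ hv1, sq, h3 _ hM]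
  norm_num

theorem mem_commonDeterminants_of_odd {σ : ℤ} (hσ : σ = 1 ∨ σ = -1) {a b c d : Fin 4 → ℤ}
    (h : Odd (extensionDet σ a b c d)) : extensionDet σ a b c d ∈ commonDeterminants := by
  have h8 := extensionDet_emod_eight h
  by_cases h16 : extensionDet σ a b c d % 16 = 1
  · exact .inl ⟨extensionDet σ a b c d / 16, by omega⟩
  have h9 : extensionDet σ a b c d % 16 = 9 := by omega
  by_contra hn
  -- If no divisor is ±3 mod 8, every character and the faithful factor are ±1 mod 8.
  have hdvd : ∀ m, m ∣ extensionDet σ a b c d → m % 8 = 1 ∨ m % 8 = 7 := by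
    intro m hm
    have h3 : ¬ (m % 8 = 3 ∨ m % 8 = 5) := fun h' => hn (mem_commonDeterminants_of_dvd h9 hm h')
    obtain ⟨k, hk⟩ := hm
    rw [hk] at h
    have := Int.odd_iff.1 (Int.odd_mul.1 h).1
    omega
  have hext : extensionDet σ a b c d = kleinDet (a + b + (c + d)) * kleinDet (a + b - (c + d)) *
      faithfulDet σ (a - b) (c - d) ^ 2 := rfl
  have hvd : kleinDet (a + b + (c + d)) ∣ extensionDet σ a b c d := by
    rw [hext, mul_assoc]; exact dvd_mul_right _ _
  have hwd : kleinDet (a + b - (c + d)) ∣ extensionDet σ a b c d := by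
    rw [hext, mul_assoc, mul_left_comm]; exact dvd_mul_right _ _
  have hMd : faithfulDet σ (a - b) (c - d) ∣ extensionDet σ a b c d := by
    rw [hext, sq, ← mul_assoc]; exact dvd_mul_left _ _
  have hchar : ∀ u : Fin 4 → ℤ, kleinDet u ∣ extensionDet σ a b c d →
      ∃ g, Odd (u g) ∧ ∃ e, (e = 0 ∨ e = 1) ∧ ∀ i ≠ g, u i % 4 = 2 * e := fun u hu =>
    exists_odd_coord_of_characters
      (hdvd _ (((dvd_mul_right _ _).trans (dvd_mul_right _ _)).trans hu))
      (hdvd _ (((dvd_mul_left _ _).trans (dvd_mul_right _ _)).trans hu))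
      (hdvd _ (((dvd_mul_right _ _).trans (dvd_mul_left _ _)).trans hu))
      (hdvd _ (((dvd_mul_left _ _).trans (dvd_mul_left _ _)).trans hu))
  obtain ⟨g, hg, e, he, hge⟩ := hchar _ hvd
  obtain ⟨g', hg', e', he', hge'⟩ := hchar _ hwd
  have hM2 : faithfulDet σ (a - b) (c - d) ^ 2 % 16 = 1 := by
    have := hdvd _ hMd
    generalize faithfulDet σ (a - b) (c - d) = M at this
    obtain hM | hM : M = 8 * (M / 8) + 1 ∨ M = 8 * (M / 8) + 7 := by omega
    all_goals
      rw [hM]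
      ring_nf
      omega
  have hv16 := kleinDet_emod_sixteen hg he hge
  have hw16 := kleinDet_emod_sixteen hg' he' hge'
  have hee : e + e' = 1 := by
    rw [hext, Int.mul_emod, Int.mul_emod (kleinDet _), hv16, hw16, hM2] at h9
    rcases he with rfl | rfl <;> rcases he' with rfl | rfl <;> simp at h9 ⊢
  simp only [Pi.add_apply, Pi.sub_apply, Int.odd_iff] at hg hg' hge hge'
  obtain rfl : g = g' := by
    by_contra hne
    have := hge' g hne
    omega
  -- Since e + e' = 1, the i-th entries of a + b ± (c + d) are 0 and 2 mod 4 in some order, so a + b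
  -- and c + d are both odd there. At g exactly one is odd, so the polar form is odd and the
  -- faithful factor is 5 mod 8.
  have hother : ∀ i ≠ g, (a i - b i) % 2 = 1 ∧ (c i - d i) % 2 = 1 := fun i hi => by
    have := hge i hi
    have := hge' i hi
    omega
  have hM5 : faithfulDet σ (a - b) (c - d) % 8 = 5 := by
    have hB : ∀ i ≠ g, (a i - b i) * (c i - d i) % 2 = 1 := fun i hi => by
      rw [Int.mul_emod, (hother i hi).1, (hother i hi).2]; rfl
    have hBg : (a g - b g) * (c g - d g) % 2 = 0 := mul_emod_two_of_ne (by omega)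
    have hcase : g = 0 ∨ g = 1 ∨ g = 2 ∨ g = 3 := by fin_cases g <;> simp
    apply faithfulDet_emod_eight σ hσ
    all_goals
      simp only [Pi.sub_apply, Int.odd_iff]
      rcases hcase with rfl | rfl | rfl | rfl
    · have := hother 1 (by decide); have := hother 2 (by decide); have := hother 3 (by decide)
      omega
    · have := hother 0 (by decide); have := hother 2 (by decide); have := hother 3 (by decide)
      omega
    · have := hother 0 (by decide); have := hother 1 (by decide); have := hother 3 (by decide)
      omega
    · have := hother 0 (by decide); have := hother 1 (by decide); have := hother 2 (by decide)
      omega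
    · have := hB 1 (by decide); have := hB 2 (by decide); have := hB 3 (by decide)
      omega
    · have := hB 0 (by decide); have := hB 2 (by decide); have := hB 3 (by decide)
      omega
    · have := hB 0 (by decide); have := hB 1 (by decide); have := hB 3 (by decide)
      omega
    · have := hB 0 (by decide); have := hB 1 (by decide); have := hB 2 (by decide)
      omega
  have := hdvd _ hMd
  omega

theorem odd_extensionDet (σ : ℤ) (hσ : σ = 1 ∨ σ = -1) (a b c d : Fin 4 → ℤ)
    (h : Odd (a 0 + a 1 + a 2 + a 3 + (b 0 + b 1 + b 2 + b 3) + (c 0 + c 1 + c 2 + c 3) +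
      (d 0 + d 1 + d 2 + d 3))) :
    Odd (extensionDet σ a b c d) := by
  rw [Int.odd_iff] at h
  have hQ : Odd (dihedralForm (a - b) (a - b) + σ * dihedralForm (c - d) (c - d)) := by
    have hp i := sq_emod_four ((a - b) i)
    have hq i := sq_emod_four ((c - d) i)
    have := hp 0; have := hp 1; have := hp 2; have := hp 3
    have := hq 0; have := hq 1; have := hq 2; have := hq 3
    have hpi i : (a - b) i = a i - b i := rfl
    have hqi i : (c - d) i = c i - d i := rfl
    have := hpi 0; have := hpi 1; have := hpi 2; have := hpi 3
    have := hqi 0; have := hqi 1; have := hqi 2; have := hqi 3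
    unfold dihedralForm
    rw [Int.odd_iff]
    rcases hσ with rfl | rfl <;> omega
  have hM : Odd (faithfulDet σ (a - b) (c - d)) :=
    hQ.pow.sub_even ⟨2 * σ * dihedralForm (a - b) (c - d) ^ 2, by ring⟩
  rw [extensionDet]
  refine (Odd.mul ?_ ?_).mul hM.pow
  all_goals
    refine (Odd.mul ?_ ?_).mul (Odd.mul ?_ ?_) <;>
    · simp only [Int.odd_iff, Pi.add_apply, Pi.sub_apply]
      omega

theorem extensionDeterminants_eq {σ : ℤ} (hσ : σ = 1 ∨ σ = -1) :
    extensionDeterminants σ = commonDeterminants := by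
  refine Set.Subset.antisymm ?_ (commonDeterminants_subset hσ)
  rintro _ ⟨a, b, c, d, rfl⟩
  rcases Int.even_or_odd (a 0 + a 1 + a 2 + a 3 + (b 0 + b 1 + b 2 + b 3) +
    (c 0 + c 1 + c 2 + c 3) + (d 0 + d 1 + d 2 + d 3)) with h | h
  · exact .inr (.inr (two_pow_sixteen_dvd_extensionDet σ hσ a b c d h))
  · exact mem_commonDeterminants_of_odd hσ (odd_extensionDet σ hσ a b c d h)

/-! ### From the groups to the determinant formulas -/

theorem integerGroupDeterminants_eq_of_equiv {G ι : Type*} [Group G] [Fintype G] [Fintype ι]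
    [DecidableEq ι] (e : ι ≃ G) :
    integerGroupDeterminants G =
      {n | ∃ f : ι → ℤ, (Matrix.of fun i j => f (e.symm (e i * (e j)⁻¹))).det = n} := by
  classical
  ext n
  constructor
  · rintro ⟨x, rfl⟩
    refine ⟨fun i => x.coeff (e i), ?_⟩
    rw [groupDeterminant, ← Matrix.det_submatrix_equiv_self e]
    simp [Matrix.submatrix]
  · rintro ⟨f, rfl⟩
    refine ⟨MonoidAlgebra.ofCoeff (Finsupp.equivFunOnFinite.symm fun g => f (e.symm g)), ?_⟩
    rw [groupDeterminant, ← Matrix.det_submatrix_equiv_self e]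
    simp [Matrix.submatrix]

/-- Indices for the elements `D`, `Y D`, `Z² D`, `Z² Y D`, with `D = {1, Z, X, ZX}`. -/
abbrev ExtensionIndex : Type := (Fin 4 ⊕ Fin 4) ⊕ (Fin 4 ⊕ Fin 4)

theorem integerGroupDeterminants_eq_extensionDeterminants {G : Type*} [Group G] [Fintype G]
    (e : ExtensionIndex ≃ G) (t : Matrix ExtensionIndex ExtensionIndex ExtensionIndex)
    (ht : ∀ i j, e (t i j) * e j = e i) {σ : ℤ}
    (h : ∀ a b c d : Fin 4 → ℤ,
      (t.map (Sum.elim (Sum.elim a c) (Sum.elim b d))).det = extensionDet σ a b c d) :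
    integerGroupDeterminants G = extensionDeterminants σ := by
  have ht' : ∀ i j, e.symm (e i * (e j)⁻¹) = t i j := fun i j => by
    rw [Equiv.symm_apply_eq, mul_inv_eq_iff_eq_mul, ht]
  rw [integerGroupDeterminants_eq_of_equiv e]
  simp only [ht']
  ext n
  constructor
  · rintro ⟨f, rfl⟩
    refine ⟨f ∘ .inl ∘ .inl, f ∘ .inr ∘ .inl, f ∘ .inl ∘ .inr, f ∘ .inr ∘ .inr, ?_⟩
    rw [← h]
    congr 1
    ext i j
    simp only [Matrix.map_apply, Matrix.of_apply]
    rcases t i j with (k | k) | (k | k) <;> rfl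
  · rintro ⟨a, b, c, d, rfl⟩
    exact ⟨_, h a b c d⟩

open Matrix in
/-- The quotients of pairs of elements when `Y ^ 2 = 1`. -/
def splitQuotients : Matrix ExtensionIndex ExtensionIndex ExtensionIndex :=
  let D := dihedralBlock (α := ExtensionIndex) (.inl ∘ .inl) (.inr ∘ .inl)
  let D' := dihedralBlock (α := ExtensionIndex) (.inr ∘ .inl) (.inl ∘ .inl)
  let E := dihedralBlock (α := ExtensionIndex) (.inl ∘ .inr) (.inr ∘ .inr)
  let E' := dihedralBlock (α := ExtensionIndex) (.inr ∘ .inr) (.inl ∘ .inr)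
  fromBlocks (fromBlocks D E E D) (fromBlocks D' E' E' D') (fromBlocks D' E' E' D')
    (fromBlocks D E E D)

open Matrix in
/-- The quotients of pairs of elements when `Y ^ 2 = Z ^ 2`. -/
def nonsplitQuotients : Matrix ExtensionIndex ExtensionIndex ExtensionIndex :=
  let D := dihedralBlock (α := ExtensionIndex) (.inl ∘ .inl) (.inr ∘ .inl)
  let D' := dihedralBlock (α := ExtensionIndex) (.inr ∘ .inl) (.inl ∘ .inl)
  let E := dihedralBlock (α := ExtensionIndex) (.inl ∘ .inr) (.inr ∘ .inr)
  let E' := dihedralBlock (α := ExtensionIndex) (.inr ∘ .inr) (.inl ∘ .inr)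
  fromBlocks (fromBlocks D E' E D) (fromBlocks D' E E' D') (fromBlocks D' E E' D')
    (fromBlocks D E' E D)

theorem det_map_splitQuotients (a b c d : Fin 4 → ℤ) :
    (splitQuotients.map (Sum.elim (Sum.elim a c) (Sum.elim b d))).det =
      extensionDet 1 a b c d := by
  rw [← det_extension_one]
  simp only [splitQuotients, Matrix.fromBlocks_map, map_dihedralBlock, ← Function.comp_assoc,
    Sum.elim_comp_inl, Sum.elim_comp_inr]

theorem det_map_nonsplitQuotients (a b c d : Fin 4 → ℤ) :
    (nonsplitQuotients.map (Sum.elim (Sum.elim a c) (Sum.elim b d))).det =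
      extensionDet (-1) a b c d := by
  rw [← det_extension_neg_one]
  simp only [nonsplitQuotients, Matrix.fromBlocks_map, map_dihedralBlock, ← Function.comp_assoc,
    Sum.elim_comp_inl, Sum.elim_comp_inr]

/-- The enumeration of the elements of `ℤ₂ × D₈`. -/
def splitElements : ExtensionIndex → Multiplicative (ZMod 2) × DihedralGroup 4 :=
  -- Here Z is `r 1` and X is `sr 0`, so ZX is `sr 3`.
  let D : Fin 4 → DihedralGroup 4 := ![.r 0, .r 1, .sr 0, .sr 3]
  Sum.elim (Sum.elim (fun k => (1, D k)) (fun k => (.ofAdd 1, D k)))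
    (Sum.elim (fun k => (1, .r 2 * D k)) (fun k => (.ofAdd 1, .r 2 * D k)))

theorem splitElements_bijective : Function.Bijective splitElements := by
  refine (Fintype.bijective_iff_injective_and_card _).2 ⟨?_, ?_⟩
  · unfold Function.Injective
    decide +kernel
  · simp [DihedralGroup.card, ZMod.card]

theorem integerGroupDeterminants_two_prod_dihedral :
    integerGroupDeterminants (Multiplicative (ZMod 2) × DihedralGroup 4) =
      extensionDeterminants 1 :=
  integerGroupDeterminants_eq_extensionDeterminants
    (Equiv.ofBijective _ splitElements_bijective) splitQuotients
    (by simp only [Equiv.ofBijective_apply]; decide +kernel) det_map_splitQuotients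

theorem integerGroupDeterminants_congr {G H : Type*} [Group G] [Fintype G] [Group H] [Fintype H]
    (e : G ≃* H) : integerGroupDeterminants G = integerGroupDeterminants H := by
  classical
  rw [integerGroupDeterminants_eq_of_equiv (Equiv.refl G),
    integerGroupDeterminants_eq_of_equiv e.toEquiv]
  simp

/-! ### The Pauli group as a model of the presentation, and non-isomorphism -/

/-- The Pauli group: `(k, b, c)` stands for `i ^ k * X ^ b * Z ^ c`. -/
def PauliGroup : Type := ZMod 4 × ZMod 2 × ZMod 2

namespace PauliGroup

instance : DecidableEq PauliGroup := inferInstanceAs (DecidableEq (ZMod 4 × ZMod 2 × ZMod 2))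

instance : Fintype PauliGroup := inferInstanceAs (Fintype (ZMod 4 × ZMod 2 × ZMod 2))

instance : Mul PauliGroup :=
  ⟨fun g h => (g.1 + h.1 + 2 * (g.2.2.val * h.2.1.val : ℕ), g.2.1 + h.2.1, g.2.2 + h.2.2)⟩

instance : One PauliGroup := ⟨((0 : ZMod 4), (0 : ZMod 2), (0 : ZMod 2))⟩

instance : Inv PauliGroup :=
  ⟨fun g => (-g.1 + 2 * (g.2.2.val * g.2.1.val : ℕ), g.2.1, g.2.2)⟩

instance : Group PauliGroup :=
  Group.ofLeftAxioms (by decide +kernel) (by decide +kernel) (by decide +kernel)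

theorem card_eq : Fintype.card PauliGroup = 16 := rfl

/-- The enumeration of the elements of the Pauli group. -/
def elements : ExtensionIndex → PauliGroup :=
  -- The presentation's Z is the product of the two Pauli generators, of square -1, so ZX carries
  -- the sign `2` in the first slot.
  let D : Fin 4 → PauliGroup := ![(0, 0, 0), (0, 1, 1), (0, 1, 0), (2, 0, 1)]
  let Y : PauliGroup := (1, 0, 0)
  Sum.elim (Sum.elim D (fun k => Y * D k)) (Sum.elim (fun k => Y ^ 2 * D k) (fun k => Y ^ 3 * D k))

theorem elements_bijective : Function.Bijective elements := by
  refine (Fintype.bijective_iff_injective_and_card _).2 ⟨?_, by simp [card_eq]⟩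
  unfold Function.Injective
  decide +kernel

theorem integerGroupDeterminants_eq :
    integerGroupDeterminants PauliGroup = extensionDeterminants (-1) :=
  integerGroupDeterminants_eq_extensionDeterminants
    (Equiv.ofBijective _ elements_bijective) nonsplitQuotients
    (by simp only [Equiv.ofBijective_apply]; decide +kernel) det_map_nonsplitQuotients

end PauliGroup

namespace SmallGroup_16_13

/-- The images of the generators in the Pauli group. -/
def genToPauli : Gen → PauliGroup
  | .X => ((0 : ZMod 4), (1 : ZMod 2), (0 : ZMod 2))
  | .Y => ((1 : ZMod 4), (0 : ZMod 2), (0 : ZMod 2))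
  | .Z => ((0 : ZMod 4), (1 : ZMod 2), (1 : ZMod 2))

theorem lift_genToPauli_relators : ∀ r ∈ relators, FreeGroup.lift genToPauli r = 1 := by
  intro r hr
  simp only [relators, Set.mem_insert_iff, Set.mem_singleton_iff] at hr
  rcases hr with rfl | rfl | rfl | rfl | rfl | rfl | rfl <;>
    simp only [map_mul, map_pow, map_inv, FreeGroup.lift_apply_of] <;> decide +kernel

/-- The homomorphism to the Pauli group. -/
noncomputable def toPauli : SmallGroup_16_13 →* PauliGroup :=
  PresentedGroup.toGroup lift_genToPauli_relators

theorem toPauli_of (s : Gen) : toPauli (PresentedGroup.of s) = genToPauli s :=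
  PresentedGroup.toGroup.of lift_genToPauli_relators

theorem toPauli_surjective : Function.Surjective toPauli := by
  have key : ∀ g : PauliGroup, ∃ i j k : Fin 4,
      genToPauli .Z ^ (i : ℕ) * genToPauli .Y ^ (j : ℕ) * genToPauli .X ^ (k : ℕ) = g := by
    decide +kernel
  intro g
  obtain ⟨i, j, k, rfl⟩ := key g
  exact ⟨PresentedGroup.of .Z ^ (i : ℕ) * PresentedGroup.of .Y ^ (j : ℕ) *
    PresentedGroup.of .X ^ (k : ℕ), by simp only [map_mul, map_pow, toPauli_of]⟩

theorem toPauli_injective : Function.Injective toPauli := by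
  -- The 32 normal forms cover 16 elements twice; the only nontrivial word for 1 is `Z ^ 2 * Y ^ 2`,
  -- which equals `Y ^ 4`.
  have key : ∀ (i j : Fin 4) (k : Fin 2),
      genToPauli .Z ^ (i : ℕ) * genToPauli .Y ^ (j : ℕ) * genToPauli .X ^ (k : ℕ) = 1 →
        i = 0 ∧ j = 0 ∧ k = 0 ∨ i = 2 ∧ j = 2 ∧ k = 0 := by decide +kernel
  have hZY : (PresentedGroup.of .Z : SmallGroup_16_13) ^ 2 = PresentedGroup.of .Y ^ 2 :=
    mul_inv_eq_one.1 <| PresentedGroup.one_of_mem (rels := relators)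
      (x := FreeGroup.of .Z ^ 2 * (FreeGroup.of .Y ^ 2)⁻¹) (by simp [relators])
  have hY : (PresentedGroup.of .Y : SmallGroup_16_13) ^ 4 = 1 :=
    PresentedGroup.one_of_mem (rels := relators) (x := FreeGroup.of .Y ^ 4) (by simp [relators])
  refine (injective_iff_map_eq_one toPauli).2 fun g hg => ?_
  obtain ⟨i, j, k, rfl⟩ := exists_normal_form g
  simp only [map_mul, map_pow, toPauli_of] at hg
  rcases key i j k hg with ⟨rfl, rfl, rfl⟩ | ⟨rfl, rfl, rfl⟩
  · simp
  · simp [hZY, ← pow_add, hY]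

/-- The group of the presentation is the Pauli group. -/
noncomputable def equivPauli : SmallGroup_16_13 ≃* PauliGroup :=
  MulEquiv.ofBijective toPauli ⟨toPauli_injective, toPauli_surjective⟩

/-- The invariant is whether every central element squares to 1; the scalar i of the Pauli group
does not. -/
theorem not_mulEquiv_two_prod_dihedral :
    IsEmpty (SmallGroup_16_13 ≃* Multiplicative (ZMod 2) × DihedralGroup 4) := by
  refine ⟨fun e => ?_⟩
  have h : ∀ g : Multiplicative (ZMod 2) × DihedralGroup 4, (∀ x, x * g = g * x) → g * g = 1 := by
    decide +kernel
  have hP : ∃ g : PauliGroup, (∀ x, x * g = g * x) ∧ g * g ≠ 1 := by decide +kernel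
  obtain ⟨g, hg, hg1⟩ := hP
  let f := equivPauli.symm.trans e
  refine hg1 (f.injective ?_)
  rw [map_mul, map_one]
  refine h _ fun x => ?_
  obtain ⟨y, rfl⟩ := f.surjective x
  rw [← map_mul, ← map_mul, hg]

end SmallGroup_16_13

theorem mainTheorem2 :
    integerGroupDeterminants SmallGroup_16_13 =
        integerGroupDeterminants (Multiplicative (ZMod 2) × DihedralGroup 4) ∧
      IsEmpty (SmallGroup_16_13 ≃* Multiplicative (ZMod 2) × DihedralGroup 4) ∧
      ¬ ∀ (G H : Type) [Group G] [Fintype G] [Group H] [Fintype H],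
          integerGroupDeterminants G = integerGroupDeterminants H → Nonempty (G ≃* H) := by
  have h : integerGroupDeterminants SmallGroup_16_13 =
      integerGroupDeterminants (Multiplicative (ZMod 2) × DihedralGroup 4) := by
    rw [integerGroupDeterminants_congr SmallGroup_16_13.equivPauli,
      PauliGroup.integerGroupDeterminants_eq, integerGroupDeterminants_two_prod_dihedral,
      extensionDeterminants_eq (.inl rfl), extensionDeterminants_eq (.inr rfl)]
  have h' := SmallGroup_16_13.not_mulEquiv_two_prod_dihedral
  exact ⟨h, h', fun H => not_isEmpty_iff.2 (H _ _ h) h'⟩
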